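/- Let $p$ be a prime and let $\mathbb{T}=\{z\in\mathbb{C}:|z|=1\}$. The $p$-adic solenoid is the compact Abelian group $$S_p=\{(y_0,y_1,\dots)\in\mathbb{T}^{\infty}: y_j=y_{j+1}^{\,p}\ \text{for all } j\ge 0\}$$ with coordinatewise multiplication (written additively below, with identity $e$) and the topology induced by the product topology. For integers $d\ge 0$ and $\ell$ let $\chi_{d,\ell}(y)=y_d^{\ell}$ be the corresponding character of $S_p$. For $b\ge 0$ let $\psi_b(\chi_{d,\ell})=b\ell^2/p^{2d}$, and let $\gamma_{\psi_b}$ be the unique Borel probability measure on $S_p$ such that $$\int_{S_p}\chi_{d,\ell}\,\mathrm{d}\gamma_{\psi_b}=e^{-\psi_b(\chi_{d,\ell})/2}\qquad\text{for all integers } d\ge 0 \text{ and } \ell.$$ Let $\omega_{S_p}$ be the Haar measure on $S_p$ with $\omega_{S_p}(S_p)=1$. For $z\in\mathbb{T}$ let $\arg z$ be the principal argument of $z$, so that $|\arg z|\le\pi$ and $z=e^{i\arg z}$. Let $x^{(n)}\in S_p$, $n\in\mathbb{N}$, with $x^{(n)}\to e$, and let $K_n$ be natural numbers with $K_n\to\infty$.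 Let $\{X_{n,k}:n\in\mathbb{N},\ 1\le k\le K_n\}$ be an array of random elements in $S_p$ such that for each $n$ the elements $X_{n,1},\dots,X_{n,K_n}$ of the $n$-th row are defined on a common probability space, are independent, and each have the distribution $\tfrac12\delta_{x^{(n)}}+\tfrac12\delta_{-x^{(n)}}$, i.e. $X_{n,k}=\pm x^{(n)}$ with probability $\tfrac12$ each. Then: 1. The array is infinitesimal: $\max_{1\le k\le K_n}\mathrm{P}(X_{n,k}\in S_p\setminus U)\to 0$ as $n\to\infty$ for every Borel neighbourhood $U$ of $e$. 2. For every real $b\ge 0$, the row sums $\sum_{k=1}^{K_n}X_{n,k}$ converge in distribution to $\gamma_{\psi_b}$ as $n\to\infty$ if and only if $K_n\,(\arg x_0^{(n)})^2\to b$. 3. The row sums $\sum_{k=1}^{K_n}X_{n,k}$ converge in distribution to $\omega_{S_p}$ as $n\to\infty$ if and only if $K_n\,(\arg x_0^{(n)})^2\to\infty$. -/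

import Mathlib

open MeasureTheory ProbabilityTheory Filter Topology
open scoped NNReal ENNReal BoundedContinuousFunction

/-- The `p`-adic solenoid `S_p = {(y₀, y₁, …) ∈ 𝕋^∞ : y_j = y_{j+1} ^ p for all j}`, a subgroup
of the product group `𝕋^∞` (written multiplicatively), with the subspace topology of the product
topology. -/
def solenoid (p : ℕ) : Subgroup (ℕ → Circle) where
  carrier := {y | ∀ j, y j = y (j + 1) ^ p}
  mul_mem' := by
    intro a b ha hb j
    simp only [Pi.mul_apply]
    rw [ha j, hb j, mul_pow]
  one_mem' := by intro j; simp
  inv_mem' := by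
    intro a ha j
    simp only [Pi.inv_apply]
    rw [ha j, inv_pow]

namespace solenoid

/-- The solenoid carries its Borel `σ`-algebra. -/
noncomputable instance instMeasurableSpace (p : ℕ) : MeasurableSpace (solenoid p) := borel _

instance instBorelSpace (p : ℕ) : BorelSpace (solenoid p) := ⟨rfl⟩

theorem isClosed (p : ℕ) : IsClosed (solenoid p : Set (ℕ → Circle)) := by
  have h : (solenoid p : Set (ℕ → Circle)) = ⋂ j, {y | y j = y (j + 1) ^ p} := by
    ext y
    simp only [Set.mem_iInter, Set.mem_ofPred_eq]
    exact Iff.rfl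
  rw [h]
  exact isClosed_iInter fun j => isClosed_eq (by fun_prop) (by fun_prop)

instance instCompactSpace (p : ℕ) : CompactSpace (solenoid p) :=
  isCompact_iff_compactSpace.mp (isClosed p).isCompact

/-- The character `χ_{d,ℓ}(y) = y_d ^ ℓ` of the solenoid, `d ∈ ℤ₊`, `ℓ ∈ ℤ`. -/
noncomputable def chi (p d : ℕ) (l : ℤ) : PontryaginDual (solenoid p) :=
  ({ toFun := fun y => (y : ℕ → Circle) d ^ l
     map_one' := by simp
     map_mul' := fun a b => by simp [mul_zpow]
     continuous_toFun :=
       ((continuous_apply d).comp continuous_subtype_val).zpow l } : solenoid p →ₜ* Circle)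

@[simp] theorem chi_apply (p d : ℕ) (l : ℤ) (y : solenoid p) :
    chi p d l y = (y : ℕ → Circle) d ^ l := rfl

/-- The quadratic form `ψ_b(χ_{d,ℓ}) = b ℓ² / p^{2d}`, as a function of the index `(d, ℓ)`. -/
noncomputable def psi (p : ℕ) (b : ℝ≥0) (d : ℕ) (l : ℤ) : ℝ :=
  (b : ℝ) * (l : ℝ) ^ 2 / (p : ℝ) ^ (2 * d)

/-- `γ` has Fourier transform `exp (-ψ_b / 2)`. -/
def IsSymmetricGauss (p : ℕ) (b : ℝ≥0) (γ : ProbabilityMeasure (solenoid p)) : Prop :=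
  ∀ (d : ℕ) (l : ℤ),
    ∫ y, (chi p d l y : ℂ) ∂(γ : Measure (solenoid p)) = Complex.exp (-(psi p b d l : ℂ) / 2)

theorem coord_eq_pow (p : ℕ) (y : solenoid p) (d k : ℕ) :
    (y : ℕ → Circle) d = (y : ℕ → Circle) (d + k) ^ p ^ k := by
  induction k with
  | zero => simp
  | succ k ih =>
    rw [ih, y.2 (d + k), ← pow_mul, pow_succ', ← add_assoc]

/-- The bounded continuous functions on the solenoid given by characters form a monoid. -/
def charSubmonoid (p : ℕ) : Submonoid (solenoid p →ᵇ ℂ) where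
  carrier := {f | ∃ (d : ℕ) (l : ℤ), ∀ y, f y = (chi p d l y : ℂ)}
  one_mem' := ⟨0, 0, fun y => by simp⟩
  mul_mem' := by
    rintro f g ⟨d, l, hf⟩ ⟨d', l', hg⟩
    refine ⟨d + d', l * (p : ℤ) ^ d' + l' * (p : ℤ) ^ d, fun y => ?_⟩
    have h1 := coord_eq_pow p y d d'
    have h2 := coord_eq_pow p y d' d
    rw [add_comm d' d] at h2
    simp only [BoundedContinuousFunction.mul_apply, hf, hg, chi_apply]
    rw [← Circle.coe_mul, h1, h2, zpow_add]
    congr 2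
    · rw [← zpow_natCast, ← zpow_mul]; push_cast; ring_nf
    · rw [← zpow_natCast, ← zpow_mul]; push_cast; ring_nf

instance instPolishSpace (p : ℕ) : PolishSpace (solenoid p) := by
  have : PolishSpace Circle := inferInstance
  exact (isClosed p).polishSpace

theorem continuous_chi (p d : ℕ) (l : ℤ) : Continuous fun y => (chi p d l y : ℂ) :=
  continuous_subtype_val.comp (map_continuous (chi p d l))

/-- A probability measure on the solenoid is determined by the integrals of the characters
`χ_{d,ℓ}`. -/
theorem ext_of_integral_chi (p : ℕ) (μ ν : Measure (solenoid p))
    [IsProbabilityMeasure μ] [IsProbabilityMeasure ν] (h : ∀ (d : ℕ) (l : ℤ), ∫ y, (chi p d l y : ℂ) ∂μ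
      = ∫ y, (chi p d l y : ℂ) ∂ν) : μ = ν := by
  let A : StarSubalgebra ℂ (solenoid p →ᵇ ℂ) :=
    StarAlgebra.adjoin ℂ (charSubmonoid p : Set (solenoid p →ᵇ ℂ))
  have hstar : star (charSubmonoid p : Set (solenoid p →ᵇ ℂ)) ⊆ charSubmonoid p := by
    rintro f ⟨d, l, hf⟩
    refine ⟨d, -l, fun y => ?_⟩
    have h1 := congrArg star (hf y)
    simp only [BoundedContinuousFunction.star_apply, star_star] at h1
    rw [h1]
    simp only [chi_apply, zpow_neg, Circle.coe_inv_eq_conj]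
    rfl
  have hA : A.toSubalgebra.toSubmodule
      = Submodule.span ℂ (charSubmonoid p : Set (solenoid p →ᵇ ℂ)) := by
    rw [StarAlgebra.adjoin_toSubalgebra, Set.union_eq_self_of_subset_right hstar,
      Algebra.adjoin_eq_span, Submonoid.closure_eq]
  have hsep : (A.map (BoundedContinuousFunction.toContinuousMapStarₐ ℂ)).SeparatesPoints := by
    intro x y hxy
    obtain ⟨d, hd⟩ : ∃ d, (x : ℕ → Circle) d ≠ (y : ℕ → Circle) d := by
      by_contra! hcon
      exact hxy (Subtype.ext (funext hcon))
    let f : solenoid p →ᵇ ℂ := BoundedContinuousFunction.mkOfCompact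
      ⟨fun z => ((z : ℕ → Circle) d : ℂ),
        continuous_subtype_val.comp ((continuous_apply d).comp continuous_subtype_val)⟩
    have hf : f ∈ A := StarAlgebra.subset_adjoin ℂ _ ⟨d, 1, fun z => by simp [f]⟩
    refine ⟨fun z => f z, ⟨BoundedContinuousFunction.toContinuousMapStarₐ ℂ f, ?_, rfl⟩, ?_⟩
    · exact ⟨f, hf, rfl⟩
    · intro hc
      exact hd (Circle.ext hc)
  have hint : ∀ g ∈ Submodule.span ℂ (charSubmonoid p : Set (solenoid p →ᵇ ℂ)),
      ∫ y, g y ∂μ = ∫ y, g y ∂ν := by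
   intro g hg
   induction hg using Submodule.span_induction with
   | mem f hf =>
     obtain ⟨d, l, hf⟩ := hf
     simp only [hf]
     exact h d l
   | zero => simp
   | add f g _ _ hf hg =>
     simp only [BoundedContinuousFunction.add_apply]
     rw [integral_add (f.integrable _) (g.integrable _),
       integral_add (f.integrable _) (g.integrable _), hf, hg]
   | smul c f _ hf =>
     simp only [BoundedContinuousFunction.smul_apply, integral_const_mul, smul_eq_mul, hf]
  refine ext_of_forall_mem_subalgebra_integral_eq_of_polish (𝕜 := ℂ) hsep fun g hg => hint g ?_
  rw [← hA]
  exact hg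

/-- The one-parameter subgroup `t ↦ (e^{it}, e^{it/p}, e^{it/p²}, …)`. -/
noncomputable def wind (p : ℕ) [Fact p.Prime] (t : ℝ) : solenoid p :=
  ⟨fun j => Circle.exp (t / (p : ℝ) ^ j), fun j => by
    have hp : (p : ℝ) ≠ 0 := Nat.cast_ne_zero.mpr (Fact.out : p.Prime).ne_zero
    rw [← Circle.exp_nsmul, nsmul_eq_mul, pow_succ]
    field_simp⟩

theorem continuous_wind (p : ℕ) [Fact p.Prime] : Continuous (wind p) := by
  unfold wind
  fun_prop

/-- There is exactly one probability measure with Fourier transform `exp (-ψ_b / 2)`. -/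
theorem existsUnique_isSymmetricGauss (p : ℕ) [Fact p.Prime] (b : ℝ≥0) :
    ∃! γ : ProbabilityMeasure (solenoid p), IsSymmetricGauss p b γ := by
  have hm : AEMeasurable (wind p) (gaussianReal 0 b) :=
    (continuous_wind p).measurable.aemeasurable
  have hex : IsSymmetricGauss p b
      ⟨(gaussianReal 0 b).map (wind p), Measure.isProbabilityMeasure_map hm⟩ := by
    intro d l
    have hc := charFun_gaussianReal (μ := 0) (v := b) ((l : ℝ) / (p : ℝ) ^ d)
    rw [charFun_apply_real] at hc
    simp only [ProbabilityMeasure.coe_mk]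
    rw [integral_map hm (continuous_chi p d l).aestronglyMeasurable]
    have he : ∀ t : ℝ, (chi p d l (wind p t) : ℂ)
        = Complex.exp (((l : ℝ) / (p : ℝ) ^ d : ℝ) * t * Complex.I) := by
      intro t
      simp only [chi_apply, wind]
      rw [← Circle.exp_zsmul, Circle.coe_exp]
      congr 2
      push_cast [zsmul_eq_mul]
      ring
    simp only [he]
    rw [hc]
    congr 1
    simp only [psi]
    push_cast
    ring
  exact ⟨_, hex, fun ν hν => Subtype.ext <|
    have : IsProbabilityMeasure (ν : Measure (solenoid p)) := ν.2
    have := Measure.isProbabilityMeasure_map hm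
    ext_of_integral_chi p ν _ fun d l => (hν d l).trans (hex d l).symm⟩

/-- The symmetric Gauss measure `γ_{ψ_b}`: the unique probability measure on the solenoid whose
Fourier transform is `exp (-ψ_b / 2)`. -/
noncomputable def gaussMeasure (p : ℕ) [Fact p.Prime] (b : ℝ≥0) :
    ProbabilityMeasure (solenoid p) :=
  (existsUnique_isSymmetricGauss p b).choose

theorem gaussMeasure_spec (p : ℕ) [Fact p.Prime] (b : ℝ≥0) :
    IsSymmetricGauss p b (gaussMeasure p b) :=
  (existsUnique_isSymmetricGauss p b).choose_spec.1

/-- The Haar measure `ω_{S_p}`, normalized by `ω_{S_p}(S_p) = 1`. -/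
noncomputable def omega (p : ℕ) : ProbabilityMeasure (solenoid p) :=
  ⟨Measure.haarMeasure ⊤, ⟨by
    simpa using Measure.haarMeasure_self (K₀ := (⊤ : TopologicalSpace.PositiveCompacts
      (solenoid p)))⟩⟩

end solenoid

/-- Infinitesimality of an array `X n k`, `k < K n`, of random elements of a group `G`, the `n`-th
row living on a probability space `(Ω n, P n)`:
`max_k P (X_{n,k} ∈ G ∖ U) → 0` for all Borel neighbourhoods `U` of the identity. -/
def IsInfinitesimalArray {G : Type*} [Group G] [TopologicalSpace G] [MeasurableSpace G]
    {Ω : ℕ → Type*} [∀ n, MeasurableSpace (Ω n)] (P : ∀ n, Measure (Ω n))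
    {K : ℕ → ℕ} (X : ∀ n, Fin (K n) → Ω n → G) : Prop :=
  ∀ U : Set G, MeasurableSet U → U ∈ 𝓝 (1 : G) →
    Tendsto (fun n => ⨆ k : Fin (K n), P n {ω | X n k ω ∉ U}) atTop (𝓝 0)

/-!
The Fourier transform `μ ↦ (∫ χ dμ)_χ` is a continuous injection of the compact space of
probability measures on `S_p` into a product of copies of `ℂ`, hence an embedding: convergence in
distribution is pointwise convergence of Fourier transforms. Put `θ_n = arg x₀⁽ⁿ⁾`. Since
`x⁽ⁿ⁾ → e`, for large `n` no winding occurs and `arg x_d⁽ⁿ⁾ = θ_n / p ^ d`, so the transform of the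
`n`-th row sum at `χ_{d,ℓ}` is `cos (ℓ θ_n / p ^ d) ^ K_n`. As `-log (cos u) ~ u² / 2` at `0`, its
limit is governed by that of `K_n θ_n²`, and conversely the single character `χ_{0,1}` recovers
the limit of `K_n θ_n²`.
-/

section CosPow

open Asymptotics

theorem isEquivalent_neg_log_cos :
    (fun u : ℝ => -Real.log (Real.cos u)) ~[𝓝 0] fun u => u ^ 2 / 2 := by
  have hlog : (fun v : ℝ => -Real.log (1 - v)) ~[𝓝 0] fun v => v := by
    have h : HasDerivAt (fun v : ℝ => -Real.log (1 - v)) 1 0 := by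
      simpa using! (((hasDerivAt_id (0 : ℝ)).const_sub 1).log (by simp)).neg
    simpa [IsEquivalent, Pi.sub_def] using h.isLittleO
  have hsin : Tendsto (fun u : ℝ => Real.sin u ^ 2) (𝓝 0) (𝓝 0) := by
    simpa using! (Real.continuous_sin.pow 2).tendsto 0
  have hlog_sin : (fun u : ℝ => -Real.log (1 - Real.sin u ^ 2)) ~[𝓝 0] fun u => u ^ 2 :=
    (hlog.comp_tendsto hsin).trans (Real.isEquivalent_sin.pow 2)
  have hlog_cos (u : ℝ) :
      -Real.log (Real.cos u) = -Real.log (1 - Real.sin u ^ 2) / 2 := by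
    rw [← Real.cos_sq', Real.log_pow]
    push_cast
    ring
  simp only [hlog_cos]
  exact hlog_sin.div IsEquivalent.refl

variable {α : Type*} {F : Filter α} {u : α → ℝ} {K : α → ℕ}

theorem isEquivalent_mul_neg_log_cos (hu : Tendsto u F (𝓝 0)) :
    (fun i => (K i : ℝ) * -Real.log (Real.cos (u i))) ~[F] fun i => (K i : ℝ) * u i ^ 2 / 2 := by
  simpa only [mul_div_assoc] using!
    (IsEquivalent.refl (u := fun i => (K i : ℝ))).mul (isEquivalent_neg_log_cos.comp_tendsto hu)

theorem cos_pow_eventuallyEq_exp (hu : Tendsto u F (𝓝 0)) :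
    (fun i => Real.cos (u i) ^ K i) =ᶠ[F]
      fun i => Real.exp (-((K i : ℝ) * -Real.log (Real.cos (u i)))) := by
  have hcos : Tendsto (fun i => Real.cos (u i)) F (𝓝 1) :=
    Real.cos_zero ▸ (Real.continuous_cos.tendsto 0).comp hu
  filter_upwards [hcos.eventually_const_lt one_pos] with i hi
  rw [mul_neg, neg_neg, Real.exp_nat_mul, Real.exp_log hi]

theorem tendsto_cos_pow_nhds_exp_iff (hu : Tendsto u F (𝓝 0)) {b : ℝ} :
    Tendsto (fun i => Real.cos (u i) ^ K i) F (𝓝 (Real.exp (-b / 2))) ↔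
      Tendsto (fun i => (K i : ℝ) * u i ^ 2) F (𝓝 b) := by
  have hdiv : Tendsto (fun i => (K i : ℝ) * u i ^ 2 / 2) F (𝓝 (b / 2)) ↔
      Tendsto (fun i => (K i : ℝ) * u i ^ 2) F (𝓝 b) := by
    refine ⟨fun h => ?_, fun h => h.div_const 2⟩
    simpa using h.mul_const 2
  rw [tendsto_congr' (cos_pow_eventuallyEq_exp hu), neg_div,
    ← hdiv, ← (isEquivalent_mul_neg_log_cos hu).tendsto_nhds_iff]
  refine ⟨fun h => ?_, fun h => (Real.continuous_exp.tendsto _).comp h.neg⟩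
  simpa using (h.log (Real.exp_ne_zero _)).neg

theorem tendsto_cos_pow_nhds_zero_iff (hu : Tendsto u F (𝓝 0)) :
    Tendsto (fun i => Real.cos (u i) ^ K i) F (𝓝 0) ↔
      Tendsto (fun i => (K i : ℝ) * u i ^ 2) F atTop := by
  rw [tendsto_congr' (cos_pow_eventuallyEq_exp hu), Real.tendsto_exp_comp_nhds_zero,
    tendsto_neg_atBot_iff, (isEquivalent_mul_neg_log_cos hu).tendsto_atTop_iff,
    tendsto_div_const_atTop_of_pos two_pos]

end CosPow

section SymmDirac

/-- The symmetric two-point distribution `½ δ_x + ½ δ_{x⁻¹}` on a group, i.e. the distribution of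
the random element equal to `x` or `x⁻¹` with probability `½` each. -/
noncomputable def symmDirac {G : Type*} [Group G] [MeasurableSpace G] (x : G) : Measure G :=
  (1 / 2 : ℝ≥0∞) • Measure.dirac x + (1 / 2 : ℝ≥0∞) • Measure.dirac x⁻¹

theorem symmDirac_eq_zero_of_notMem {G : Type*} [Group G] [MeasurableSpace G] {x : G} {s : Set G}
    (hs : MeasurableSet s) (hx : x ∉ s) (hx' : x⁻¹ ∉ s) : symmDirac x s = 0 := by
  simp [symmDirac, hs, hx, hx']

theorem isInfinitesimalArray_of_hasLaw_symmDirac {G : Type*} [Group G] [TopologicalSpace G]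
    [ContinuousInv G] [MeasurableSpace G] {x : ℕ → G} (hx : Tendsto x atTop (𝓝 1)) {K : ℕ → ℕ}
    {Ω : ℕ → Type*} [∀ n, MeasurableSpace (Ω n)] {P : ∀ n, Measure (Ω n)}
    {X : ∀ n, Fin (K n) → Ω n → G} (hlaw : ∀ n k, HasLaw (X n k) (symmDirac (x n)) (P n)) :
    IsInfinitesimalArray P X := by
  intro U hU hU1
  have hx' : Tendsto (fun n => (x n)⁻¹) atTop (𝓝 1) := by simpa using hx.inv
  refine tendsto_const_nhds.congr' ?_
  filter_upwards [hx hU1, hx' hU1] with n hn hn'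
  have hnull (k : Fin (K n)) : P n {ω | X n k ω ∉ U} = 0 :=
    ((hlaw n k).measure_eq hU.compl).trans
      (symmDirac_eq_zero_of_notMem hU.compl (not_not_intro hn) (not_not_intro hn'))
  simp only [hnull, ENNReal.iSup_zero]

theorem integral_symmDirac {G E : Type*} [Group G] [MeasurableSpace G] [MeasurableSingletonClass G]
    [NormedAddCommGroup E] [NormedSpace ℝ E] [CompleteSpace E] (f : G → E) (x : G) :
    ∫ y, f y ∂symmDirac x = (1 / 2 : ℝ) • (f x + f x⁻¹) := by
  have hintegrable (y : G) : Integrable f ((1 / 2 : ℝ≥0∞) • Measure.dirac y) :=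
    (integrable_dirac enorm_lt_top).smul_measure (by simp)
  rw [symmDirac, integral_add_measure (hintegrable _) (hintegrable _)]
  simp [smul_add]

end SymmDirac

section Character

variable {G H : Type*} [MeasurableSpace G] [FunLike H G Circle]

theorem integral_character_eq_zero [Group G] [MeasurableMul G] [MonoidHomClass H G Circle]
    (μ : Measure G) [μ.IsMulLeftInvariant] {χ : H} {g : G} (hg : χ g ≠ 1) :
    ∫ y, (χ y : ℂ) ∂μ = 0 := by
  have htranslate : (χ g : ℂ) * ∫ y, (χ y : ℂ) ∂μ = ∫ y, (χ y : ℂ) ∂μ := by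
    simpa [integral_const_mul] using integral_mul_left_eq_self (μ := μ) (fun y => (χ y : ℂ)) g
  by_contra hne
  exact hg (Circle.ext ((mul_eq_right₀ hne).1 htranslate))

variable [MeasurableSingletonClass G]

theorem integral_character_symmDirac [Group G] [MonoidHomClass H G Circle] (χ : H) (x : G) :
    ∫ y, (χ y : ℂ) ∂symmDirac x = ((χ x : ℂ).re : ℂ) := by
  rw [integral_symmDirac, map_inv, Circle.coe_inv_eq_conj, Complex.re_eq_add_conj,
    Complex.real_smul]
  push_cast
  ring

theorem integral_character_prod_of_hasLaw_symmDirac [CommGroup G] [MonoidHomClass H G Circle]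
    {χ : H} (hχ : Measurable fun y => (χ y : ℂ)) {x : G} {ι Ω : Type*} [Fintype ι]
    [MeasurableSpace Ω] {P : Measure Ω} {X : ι → Ω → G} (hindep : iIndepFun X P)
    (hlaw : ∀ k, HasLaw (X k) (symmDirac x) P) :
    ∫ ω, (χ (∏ k, X k ω) : ℂ) ∂P = (((χ x : ℂ).re ^ Fintype.card ι : ℝ) : ℂ) := by
  calc ∫ ω, (χ (∏ k, X k ω) : ℂ) ∂P
      = ∫ ω, ∏ k, (χ (X k ω) : ℂ) ∂P :=
        integral_congr_ae <| .of_forall fun _ =>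
          (congrArg Circle.coeHom (map_prod χ _ _)).trans (map_prod Circle.coeHom _ _)
    _ = ∏ k, ∫ ω, (χ (X k ω) : ℂ) ∂P :=
        hindep.integral_fun_prod_comp (fun k => (hlaw k).aemeasurable)
          fun _ => hχ.aestronglyMeasurable
    _ = ∏ _k : ι, ∫ y, (χ y : ℂ) ∂symmDirac x :=
        Finset.prod_congr rfl fun k _ => (hlaw k).integral_comp hχ.aestronglyMeasurable
    _ = (((χ x : ℂ).re ^ Fintype.card ι : ℝ) : ℂ) := by
        simp [integral_character_symmDirac]

end Character

namespace solenoid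

section FourierTransform

variable (p : ℕ)

/-- The Fourier transform `μ̂(χ_{d,ℓ}) = ∫ χ_{d,ℓ} dμ` of a probability measure on the solenoid. It
is encoded as a function of the index `(d, ℓ)` rather than of the character, so that the same
character is listed under several indices. -/
noncomputable def fourierTransform (μ : ProbabilityMeasure (solenoid p)) (d : ℕ) (l : ℤ) : ℂ :=
  ∫ y, (chi p d l y : ℂ) ∂(μ : Measure (solenoid p))

theorem continuous_fourierTransform : Continuous (fourierTransform p) :=
  continuous_pi fun d => continuous_pi fun l => continuous_iff_continuousAt.2 fun _ =>
    (ProbabilityMeasure.tendsto_iff_forall_integral_rclike_tendsto ℂ).1 tendsto_id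
      (BoundedContinuousFunction.mkOfCompact ⟨_, continuous_chi p d l⟩)

theorem injective_fourierTransform : Function.Injective (fourierTransform p) := fun μ ν h =>
  Subtype.ext (ext_of_integral_chi p μ ν fun d l => congrFun (congrFun h d) l)

theorem isClosedEmbedding_fourierTransform : IsClosedEmbedding (fourierTransform p) :=
  (continuous_fourierTransform p).isClosedEmbedding (injective_fourierTransform p)

variable {p}

theorem tendsto_iff_tendsto_fourierTransform {α : Type*} {F : Filter α}
    {μ : α → ProbabilityMeasure (solenoid p)} {ν : ProbabilityMeasure (solenoid p)} :
    Tendsto μ F (𝓝 ν) ↔ ∀ d l,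
      Tendsto (fun i => fourierTransform p (μ i) d l) F (𝓝 (fourierTransform p ν d l)) := by
  simp only [(isClosedEmbedding_fourierTransform p).tendsto_nhds_iff, tendsto_pi_nhds,
    Function.comp_apply]

theorem tendstoInDistribution_iff_tendsto_integral_chi {α : Type*} {F : Filter α}
    {Ω : α → Type*} [∀ i, MeasurableSpace (Ω i)] {P : ∀ i, Measure (Ω i)}
    [∀ i, IsProbabilityMeasure (P i)] {S : ∀ i, Ω i → solenoid p}
    (hS : ∀ i, AEMeasurable (S i) (P i)) {ν : ProbabilityMeasure (solenoid p)} :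
    TendstoInDistribution S F id P (ν : Measure (solenoid p)) ↔ ∀ d l,
      Tendsto (fun i => ∫ ω, (chi p d l (S i ω) : ℂ) ∂P i) F (𝓝 (fourierTransform p ν d l)) := by
  have hmap (i : α) (d : ℕ) (l : ℤ) :
      ∫ y, (chi p d l y : ℂ) ∂(P i).map (S i) = ∫ ω, (chi p d l (S i ω) : ℂ) ∂P i :=
    integral_map (hS i) (continuous_chi p d l).aestronglyMeasurable
  refine ⟨fun h d l => ?_, fun h => ⟨hS, aemeasurable_id, ?_⟩⟩
  · simpa only [fourierTransform, ProbabilityMeasure.coe_mk, hmap, Measure.map_id] using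
      tendsto_iff_tendsto_fourierTransform.1 h.tendsto d l
  · refine tendsto_iff_tendsto_fourierTransform.2 fun d l => ?_
    simpa only [fourierTransform, ProbabilityMeasure.coe_mk, hmap, Measure.map_id] using h d l

theorem exists_chi_ne_one [NeZero p] (d : ℕ) {l : ℤ} (hl : l ≠ 0) : ∃ y, chi p d l y ≠ 1 := by
  have hp : (p : ℝ) ≠ 0 := NeZero.ne _
  have hl' : (l : ℝ) ≠ 0 := Int.cast_ne_zero.2 hl
  let y : solenoid p := ⟨fun j => Circle.exp (Real.pi * p ^ d / (l * p ^ j)), fun j => by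
    rw [← Circle.exp_nsmul, nsmul_eq_mul, pow_succ]
    field_simp⟩
  have hy : chi p d l y = Circle.exp Real.pi := by
    rw [chi_apply, ← Circle.exp_zsmul, zsmul_eq_mul]
    field_simp
  refine ⟨y, ?_⟩
  rw [hy, ne_eq, Circle.ext_iff, Circle.coe_exp, Complex.exp_pi_mul_I, Circle.coe_one]
  norm_num

theorem fourierTransform_omega_eq_zero [NeZero p] (d : ℕ) {l : ℤ} (hl : l ≠ 0) :
    fourierTransform p (omega p) d l = 0 :=
  have ⟨_, hg⟩ := exists_chi_ne_one (p := p) d hl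
  integral_character_eq_zero (Measure.haarMeasure ⊤) hg

end FourierTransform

section Argument

variable {p : ℕ} {α : Type*} {F : Filter α} {x : α → solenoid p}

theorem re_chi (d : ℕ) (l : ℤ) (y : solenoid p) :
    (chi p d l y : ℂ).re = Real.cos (l * ((y : ℕ → Circle) d : ℂ).arg) := by
  have h : chi p d l y = Circle.exp (l * ((y : ℕ → Circle) d : ℂ).arg) := by
    rw [← zsmul_eq_mul, Circle.exp_zsmul, Circle.exp_arg, chi_apply]
  rw [h, Circle.coe_exp, Complex.exp_ofReal_mul_I_re]

theorem tendsto_arg_coord (hx : Tendsto x F (𝓝 1)) (d : ℕ) :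
    Tendsto (fun i => ((x i : ℕ → Circle) d : ℂ).arg) F (𝓝 0) := by
  have hcont : Continuous fun y : solenoid p => ((y : ℕ → Circle) d : ℂ) := by
    simpa using continuous_chi p d 1
  have hcoord : Tendsto (fun i => ((x i : ℕ → Circle) d : ℂ)) F (𝓝 1) :=
    (hcont.tendsto 1).comp hx
  simpa using! (Complex.continuousAt_arg Complex.one_mem_slitPlane).tendsto.comp hcoord

theorem tendsto_const_mul_arg_coord (hx : Tendsto x F (𝓝 1)) (c : ℝ) (d : ℕ) :
    Tendsto (fun i => c * ((x i : ℕ → Circle) d : ℂ).arg) F (𝓝 0) := by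
  simpa using (tendsto_arg_coord hx d).const_mul c

variable [NeZero p]

theorem eventually_arg_coord_eq_div (hx : Tendsto x F (𝓝 1)) (d : ℕ) :
    ∀ᶠ i in F, ((x i : ℕ → Circle) d : ℂ).arg = ((x i : ℕ → Circle) 0 : ℂ).arg / (p : ℝ) ^ d := by
  filter_upwards [(tendsto_const_mul_arg_coord hx ((p : ℝ) ^ d) d).eventually
    (Ioo_mem_nhds (neg_lt_zero.2 Real.pi_pos) Real.pi_pos)] with i hi
  have hcoord : (x i : ℕ → Circle) 0 =
      Circle.exp ((p : ℝ) ^ d * ((x i : ℕ → Circle) d : ℂ).arg) := by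
    rw [coord_eq_pow p (x i) 0 d, zero_add, ← Nat.cast_pow, ← nsmul_eq_mul, Circle.exp_nsmul,
      Circle.exp_arg]
  rw [hcoord, Circle.arg_exp hi.1 hi.2.le, mul_div_cancel_left₀ _ (NeZero.ne _)]

theorem eventually_re_chi_eq_cos (hx : Tendsto x F (𝓝 1)) (d : ℕ) (l : ℤ) :
    ∀ᶠ i in F, (chi p d l (x i) : ℂ).re =
      Real.cos (l / (p : ℝ) ^ d * ((x i : ℕ → Circle) 0 : ℂ).arg) := by
  filter_upwards [eventually_arg_coord_eq_div hx d] with i hi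
  rw [re_chi, hi, mul_div_assoc', div_mul_eq_mul_div]

end Argument

section RowProducts

variable {p : ℕ} [NeZero p] {α : Type*} {F : Filter α} {x : α → solenoid p}
  {K : α → ℕ} {Ω : α → Type*} [∀ i, MeasurableSpace (Ω i)] {P : ∀ i, Measure (Ω i)}
  [∀ i, IsProbabilityMeasure (P i)] {X : ∀ i, Fin (K i) → Ω i → solenoid p}

theorem tendstoInDistribution_prod_iff_tendsto_cos_pow (hx : Tendsto x F (𝓝 1))
    (hindep : ∀ i, iIndepFun (X i) (P i))
    (hlaw : ∀ i k, HasLaw (X i k) (symmDirac (x i)) (P i))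
    {ν : ProbabilityMeasure (solenoid p)} :
    TendstoInDistribution (fun i ω => ∏ k, X i k ω) F id P (ν : Measure (solenoid p)) ↔
      ∀ d (l : ℤ), Tendsto (fun i => ((Real.cos
        (l / (p : ℝ) ^ d * ((x i : ℕ → Circle) 0 : ℂ).arg) ^ K i : ℝ) : ℂ)) F
          (𝓝 (fourierTransform p ν d l)) := by
  have hS (i : α) : AEMeasurable (fun ω => ∏ k, X i k ω) (P i) :=
    Finset.aemeasurable_fun_prod _ fun k _ => (hlaw i k).aemeasurable
  rw [tendstoInDistribution_iff_tendsto_integral_chi hS]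
  refine forall₂_congr fun d l => tendsto_congr' ?_
  filter_upwards [eventually_re_chi_eq_cos hx d l] with i hi
  rw [integral_character_prod_of_hasLaw_symmDirac (continuous_chi p d l).measurable
    (hindep i) (hlaw i), hi, Fintype.card_fin]

theorem tendstoInDistribution_prod_gauss_iff (hx : Tendsto x F (𝓝 1))
    (hindep : ∀ i, iIndepFun (X i) (P i))
    (hlaw : ∀ i k, HasLaw (X i k) (symmDirac (x i)) (P i))
    {b : ℝ≥0} {γ : ProbabilityMeasure (solenoid p)} (hγ : IsSymmetricGauss p b γ) :
    TendstoInDistribution (fun i ω => ∏ k, X i k ω) F id P (γ : Measure (solenoid p)) ↔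
      Tendsto (fun i => (K i : ℝ) * ((x i : ℕ → Circle) 0 : ℂ).arg ^ 2) F (𝓝 (b : ℝ)) := by
  have hγ' (d : ℕ) (l : ℤ) : fourierTransform p γ d l =
      ((Real.exp (-(b * (l / (p : ℝ) ^ d) ^ 2) / 2) : ℝ) : ℂ) := by
    rw [fourierTransform, hγ, psi, pow_mul', div_pow, mul_div_assoc]
    push_cast
    rfl
  simp only [tendstoInDistribution_prod_iff_tendsto_cos_pow hx hindep hlaw, hγ',
    tendsto_ofReal_iff, tendsto_cos_pow_nhds_exp_iff (tendsto_const_mul_arg_coord hx _ 0)]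
  refine ⟨fun h => by simpa using h 0 1, fun h d l => ?_⟩
  simpa only [mul_pow, mul_left_comm, mul_comm] using h.const_mul ((l / (p : ℝ) ^ d) ^ 2)

theorem tendstoInDistribution_prod_omega_iff (hx : Tendsto x F (𝓝 1))
    (hindep : ∀ i, iIndepFun (X i) (P i))
    (hlaw : ∀ i k, HasLaw (X i k) (symmDirac (x i)) (P i)) :
    TendstoInDistribution (fun i ω => ∏ k, X i k ω) F id P (omega p : Measure (solenoid p)) ↔
      Tendsto (fun i => (K i : ℝ) * ((x i : ℕ → Circle) 0 : ℂ).arg ^ 2) F atTop := by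
  have hne {l : ℤ} (hl : l ≠ 0) (d : ℕ) : Tendsto (fun i => ((Real.cos
      (l / (p : ℝ) ^ d * ((x i : ℕ → Circle) 0 : ℂ).arg) ^ K i : ℝ) : ℂ)) F
        (𝓝 (fourierTransform p (omega p) d l)) ↔
      Tendsto (fun i => (K i : ℝ) * (l / (p : ℝ) ^ d * ((x i : ℕ → Circle) 0 : ℂ).arg) ^ 2) F
        atTop := by
    rw [fourierTransform_omega_eq_zero d hl, ← Complex.ofReal_zero, tendsto_ofReal_iff,
      tendsto_cos_pow_nhds_zero_iff (tendsto_const_mul_arg_coord hx _ 0)]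
  rw [tendstoInDistribution_prod_iff_tendsto_cos_pow hx hindep hlaw]
  refine ⟨fun h => by simpa using (hne one_ne_zero 0).1 (h 0 1), fun h d l => ?_⟩
  rcases eq_or_ne l 0 with rfl | hl
  · simp [fourierTransform, tendsto_const_nhds]
  · have hc : 0 < (l / (p : ℝ) ^ d) ^ 2 :=
      sq_pos_of_ne_zero (div_ne_zero (Int.cast_ne_zero.2 hl) (NeZero.ne _))
    refine (hne hl d).2 ?_
    simpa only [mul_pow, mul_left_comm, mul_comm] using h.const_mul_atTop hc

end RowProducts

end solenoid

theorem mainTheorem12_general (p : ℕ) [NeZero p]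
    (x : ℕ → solenoid p) (hx : Tendsto x atTop (𝓝 1)) (K : ℕ → ℕ)
    {Ω : ℕ → Type*} [∀ n, MeasurableSpace (Ω n)]
    (P : ∀ n, Measure (Ω n)) [∀ n, IsProbabilityMeasure (P n)]
    (X : ∀ n, Fin (K n) → Ω n → solenoid p)
    (hindep : ∀ n, iIndepFun (X n) (P n))
    (hlaw : ∀ n k, HasLaw (X n k) (symmDirac (x n)) (P n)) :
    IsInfinitesimalArray P X ∧
    (∀ (b : ℝ≥0) (γ : ProbabilityMeasure (solenoid p)), solenoid.IsSymmetricGauss p b γ →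
      (TendstoInDistribution (fun n ω => ∏ k, X n k ω) atTop id P (γ : Measure (solenoid p)) ↔
        Tendsto (fun n => (K n : ℝ) * (((x n : ℕ → Circle) 0 : ℂ).arg) ^ 2) atTop
          (𝓝 (b : ℝ)))) ∧
    (TendstoInDistribution (fun n ω => ∏ k, X n k ω) atTop id P
          (solenoid.omega p : Measure (solenoid p)) ↔
        Tendsto (fun n => (K n : ℝ) * (((x n : ℕ → Circle) 0 : ℂ).arg) ^ 2) atTop atTop) :=
  ⟨isInfinitesimalArray_of_hasLaw_symmDirac hx hlaw,
    fun _ _ hγ => solenoid.tendstoInDistribution_prod_gauss_iff hx hindep hlaw hγ,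
    solenoid.tendstoInDistribution_prod_omega_iff hx hindep hlaw⟩

theorem mainTheorem12 (p : ℕ) [Fact p.Prime]
    (x : ℕ → solenoid p) (hx : Tendsto x atTop (𝓝 1))
    (K : ℕ → ℕ) (hK : Tendsto K atTop atTop)
    {Ω : ℕ → Type*} [∀ n, MeasurableSpace (Ω n)]
    (P : ∀ n, Measure (Ω n)) [∀ n, IsProbabilityMeasure (P n)]
    (X : ∀ n, Fin (K n) → Ω n → solenoid p)
    (hmeas : ∀ n k, Measurable (X n k))
    (hindep : ∀ n, iIndepFun (X n) (P n))
    (hlaw : ∀ n k, (P n).map (X n k) =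
      (1 / 2 : ℝ≥0∞) • Measure.dirac (x n) + (1 / 2 : ℝ≥0∞) • Measure.dirac (x n)⁻¹) :
    IsInfinitesimalArray P X ∧
    (∀ b : ℝ≥0,
      TendstoInDistribution (fun n ω => ∏ k, X n k ω) atTop id P
          (solenoid.gaussMeasure p b : Measure (solenoid p)) ↔
        Tendsto (fun n => (K n : ℝ) * (((x n : ℕ → Circle) 0 : ℂ).arg) ^ 2) atTop
          (𝓝 (b : ℝ))) ∧
    (TendstoInDistribution (fun n ω => ∏ k, X n k ω) atTop id P
          (solenoid.omega p : Measure (solenoid p)) ↔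
        Tendsto (fun n => (K n : ℝ) * (((x n : ℕ → Circle) 0 : ℂ).arg) ^ 2) atTop atTop) := by
  have : NeZero p := ⟨(Fact.out : p.Prime).ne_zero⟩
  have ⟨hinf, hgauss, homega⟩ := mainTheorem12_general p x hx K P X hindep
    fun n k => ⟨(hmeas n k).aemeasurable, hlaw n k⟩
  exact ⟨hinf, fun b => hgauss b _ (solenoid.gaussMeasure_spec p b), homega⟩
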